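/- Proposition 5.2. Let $d\ge 2$, $1\le p<\infty$, $s\in(0,1]$ with $ps>1$, and let $\Omega\subset\mathbb R^d$ be a bounded Lipschitz domain, that is, a bounded open set whose boundary $\partial\Omega$ is covered by finitely many bounded open sets $O_1,\dots,O_N$ such that $\Omega\cap O_j=\Omega_j\cap O_j$ for each $j$, where $\Omega_j$ is the image under a rigid motion of a set $\{(x',x_d)\in\mathbb R^{d-1}\times\mathbb R: x_d>\zeta_j(x')\}$ with $\zeta_j:\mathbb R^{d-1}\to\mathbb R$ Lipschitz. (Connectedness is not required.) Write $\delta(x)=\operatorname{dist}(x,\partial\Omega)$, let $B_r(x)$ be the ball of radius $r$ and centre $x$, and for $u\in L^p(\Omega)$ put $$|u|^p_{\mathfrak W^{s,p}(\Omega)}=\int_\Omega\int_{\Omega\cap B_{\delta(x)}(x)}\frac{|u(y)-u(x)|^p}{\delta(x)^{d+ps}}\,dy\,dx,\qquad \|u\|_{\mathfrak W^{s,p}(\Omega)}=\Big(\|u\|_{L^p(\Omega)}^p+|u|^p_{\mathfrak W^{s,p}(\Omega)}\Big)^{1/p}.$$ Let $\mathring{\mathfrak W}^{s,p}(\Omega)$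 be the closure, with respect to $\|\cdot\|_{\mathfrak W^{s,p}(\Omega)}$, of the set of Lipschitz functions with compact support in $\Omega$; that is, the set of all $u\in L^p(\Omega)$ such that for every $\varepsilon>0$ there is such a function $\varphi$ with $\|u-\varphi\|_{\mathfrak W^{s,p}(\Omega)}<\varepsilon$. Then there is a constant $C>0$ (depending on $d,s,p,\Omega$ but not on $u$) such that every $u\in\mathring{\mathfrak W}^{s,p}(\Omega)$ satisfies $\|u\|_{\mathfrak W^{s,p}(\Omega)}<\infty$ and $$\int_\Omega\frac{|u(x)|^p}{\operatorname{dist}(x,\partial\Omega)^{ps}}\,dx\le C\,\|u\|^p_{\mathfrak W^{s,p}(\Omega)}.$$ -/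

import Mathlib

open MeasureTheory
open scoped ENNReal NNReal

noncomputable section

namespace NonlocalHardy

/-- The distance `δ(x) = dist(x, ∂Ω)` to the boundary of `Ω`. -/
def bdryDist {d : ℕ} (Ω : Set (EuclideanSpace ℝ (Fin d))) (x : EuclideanSpace ℝ (Fin d)) : ℝ :=
  Metric.infDist x (frontier Ω)

/-- The `p`-th power of the seminorm,
`∫_Ω ∫_{Ω ∩ B_{δ(x)}(x)} |u(y) - u(x)| ^ p / δ(x) ^ (d + p s) dy dx`, with values in `[0, ∞]`. -/
def seminormPow {d : ℕ} (s p : ℝ) (Ω : Set (EuclideanSpace ℝ (Fin d)))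
    (u : EuclideanSpace ℝ (Fin d) → ℝ) : ℝ≥0∞ :=
  ∫⁻ x in Ω, ∫⁻ y in Ω ∩ Metric.ball x (bdryDist Ω x),
    ENNReal.ofReal (|u y - u x| ^ p / bdryDist Ω x ^ ((d : ℝ) + p * s))

/-- The norm `(‖u‖_{L^p(Ω)} ^ p + |u| ^ p) ^ (1 / p)`, with values in `[0, ∞]`. -/
def fullNorm {d : ℕ} (s p : ℝ) (Ω : Set (EuclideanSpace ℝ (Fin d)))
    (u : EuclideanSpace ℝ (Fin d) → ℝ) : ℝ≥0∞ :=
  (eLpNorm u (ENNReal.ofReal p) (volume.restrict Ω) ^ p + seminormPow s p Ω u) ^ (1 / p)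

/-- Lipschitz functions with compact support contained in `Ω` (extended by zero outside `Ω`;
the extension of such a function on `Ω` is Lipschitz on the whole space). -/
def IsLipschitzCompactlySupportedIn {d : ℕ} (Ω : Set (EuclideanSpace ℝ (Fin d)))
    (φ : EuclideanSpace ℝ (Fin d) → ℝ) : Prop :=
  (∃ K : ℝ≥0, LipschitzWith K φ) ∧ HasCompactSupport φ ∧ tsupport φ ⊆ Ω

/-- The space of the functions of `L^p(Ω)` that are limits, in the norm `fullNorm`, of Lipschitz
functions with compact support in `Ω`. Functions are given by representatives; only their values
on `Ω`, up to a null set, matter. -/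
def zeroBdrySpace {d : ℕ} (s p : ℝ) (Ω : Set (EuclideanSpace ℝ (Fin d))) :
    Set (EuclideanSpace ℝ (Fin d) → ℝ) :=
  {u | MemLp u (ENNReal.ofReal p) (volume.restrict Ω) ∧
    ∀ ε : ℝ≥0∞, 0 < ε → ∃ φ : EuclideanSpace ℝ (Fin d) → ℝ,
      IsLipschitzCompactlySupportedIn Ω φ ∧ fullNorm s p Ω (u - φ) < ε}

/-- `D ⊆ ℝ^d` is a Lipschitz hypograph up to a rigid motion: in suitable Euclidean coordinates
`(x', x_d) ∈ ℝ^(d-1) × ℝ` it is the set `x_d > ζ(x')` for a Lipschitz function `ζ`. The type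
`WithLp 2 (_ × ℝ)` is the product with the Euclidean distance. -/
def IsRigidLipschitzHypograph {d : ℕ} (D : Set (EuclideanSpace ℝ (Fin d))) : Prop :=
  ∃ (e : EuclideanSpace ℝ (Fin d) ≃ᵢ WithLp 2 (EuclideanSpace ℝ (Fin (d - 1)) × ℝ))
    (ζ : EuclideanSpace ℝ (Fin (d - 1)) → ℝ) (L : ℝ≥0),
    LipschitzWith L ζ ∧ D = {x | ζ (e x).fst < (e x).snd}

/-- Lipschitz domains: open sets with compact boundary which, near every boundary point, coincide
with a rigidly moved Lipschitz hypograph. No connectedness is required. -/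
def IsLipschitzDomain {d : ℕ} (Ω : Set (EuclideanSpace ℝ (Fin d))) : Prop :=
  IsOpen Ω ∧ IsCompact (frontier Ω) ∧
    ∃ (N : ℕ) (O D : Fin N → Set (EuclideanSpace ℝ (Fin d))),
      (∀ j, IsOpen (O j) ∧ Bornology.IsBounded (O j)) ∧ frontier Ω ⊆ ⋃ j, O j ∧
      (∀ j, IsRigidLipschitzHypograph (D j)) ∧ ∀ j, Ω ∩ O j = D j ∩ O j

end NonlocalHardy

end

noncomputable section

namespace NonlocalHardy

open Set Module

/-! The inequality comes from a dilation. In the half-space, sending a point of height `t` over `x'`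
to `(x' + t z, t m)` with `m < 1` multiplies the weighted integral `I` of `|F|^p t^(-α)` by
`m^(α-1)`, which is below 1 because `α = p s > 1`. Comparing `F` at a point and at its image gives
`I ≤ A I + B J` with `A < 1`, where `J` collects the differences. If `I` is finite it is absorbed,
and averaging over `(z, m)` turns `J` into an integral over balls of radius `κ t`
(`hardy_upperHalf`).

Volume-preserving bi-Lipschitz charts flatten the boundary
(`IsRigidLipschitzHypograph.exists_chart`). Near a boundary point the height is comparable with `δ`
(`height_comparable`), so for small `κ` the half-space balls pull back into the balls of radius
`δ(x)`. Cutting off costs a multiple of the energy, since `s ≤ 1` (`exists_energy_mul_le`), and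
compact support in `Ω` supplies the finiteness of `I`. Compactness of the boundary glues the local
estimates; away from it `δ` is bounded below (`exists_hardy_of_lipschitz`).

The closure is reached by working first on `{δ > η}`, where the weight is bounded, with a final
constant free of `η` (`hardy_of_approx`). -/

/-! ### Inequalities for `p`-th powers -/

/-- Convexity of `t ^ p` with weights `θ` and `1 - θ`. As `θ` tends to 1 the coefficient of `|b| ^
p` tends to 1, which is what leaves room for absorption. -/
theorem abs_rpow_le_add {p θ : ℝ} (hp : 1 ≤ p) (h0 : 0 < θ) (h1 : θ < 1) (a b : ℝ) :
    |a| ^ p ≤ θ ^ (1 - p) * |b| ^ p + (1 - θ) ^ (1 - p) * |b - a| ^ p := by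
  have h2 : 0 < 1 - θ := by linarith
  have key := (convexOn_rpow hp).2 (x := |b| / θ) (y := |b - a| / (1 - θ))
    (by simp only [mem_Ici]; positivity) (by simp only [mem_Ici]; positivity) h0.le h2.le (by ring)
  simp only [smul_eq_mul] at key
  have e (c r : ℝ) (hc : 0 ≤ c) (hr : 0 < r) : r * (c / r) ^ p = r ^ (1 - p) * c ^ p := by
    rw [Real.div_rpow hc hr.le, Real.rpow_sub hr, Real.rpow_one]; ring
  rw [e _ _ (abs_nonneg _) h0, e _ _ (abs_nonneg _) h2, mul_div_cancel₀ _ h0.ne',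
    mul_div_cancel₀ _ h2.ne'] at key
  refine le_trans (Real.rpow_le_rpow (abs_nonneg _) ?_ (by linarith)) key
  have := abs_sub b (b - a)
  simpa using this

theorem abs_add_rpow_le {p : ℝ} (hp : 1 ≤ p) (a b : ℝ) :
    |a + b| ^ p ≤ 2 ^ p * (|a| ^ p + |b| ^ p) := by
  have h := abs_rpow_le_add hp (θ := 1 / 2) (by norm_num) (by norm_num) (a + b) a
  have e : (1 / 2 : ℝ) ^ (1 - p) ≤ 2 ^ p := by
    rw [one_div, Real.inv_rpow (by norm_num), ← Real.rpow_neg (by norm_num)]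
    exact Real.rpow_le_rpow_of_exponent_le (by norm_num) (by linarith)
  have e' : (1 - 1 / 2 : ℝ) = 1 / 2 := by norm_num
  rw [e', ← mul_add, sub_add_cancel_left, abs_neg] at h
  exact h.trans (mul_le_mul_of_nonneg_right e (by positivity))

/-! ### The Hardy inequality in the half-space -/

theorem lintegral_comp_add_smul {X : Type*} [NormedAddCommGroup X] [NormedSpace ℝ X]
    [FiniteDimensional ℝ X] [MeasurableSpace X] [BorelSpace X] (μ : Measure X)
    [μ.IsAddHaarMeasure] {f : X → ℝ≥0∞} (hf : Measurable f) (c : X) {t : ℝ} (ht : 0 < t) :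
    ∫⁻ w, f (c + t • w) ∂μ = ENNReal.ofReal ((t ^ finrank ℝ X)⁻¹) * ∫⁻ w, f w ∂μ := by
  have h1 := lintegral_map (μ := μ) (f := fun w => f (c + w)) (g := (t • · : X → X))
    (by fun_prop) (by fun_prop)
  rw [Measure.map_addHaar_smul μ ht.ne', lintegral_smul_measure, lintegral_add_left_eq_self,
    abs_of_pos (by positivity)] at h1
  exact h1.symm

/-- The upper half-space `{(x', t) : 0 < t}`. -/
def upperHalf (V : Type*) : Set (V × ℝ) := {x | 0 < x.2}

theorem measurableSet_upperHalf {V : Type*} [MeasurableSpace V] : MeasurableSet (upperHalf V) :=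
  measurableSet_lt measurable_const measurable_snd

theorem setLIntegral_upperHalf {V : Type*} [MeasureSpace V] [SFinite (volume : Measure V)]
    {f : V × ℝ → ℝ≥0∞} (hf : Measurable f) :
    ∫⁻ x in upperHalf V, f x = ∫⁻ t in Ioi (0 : ℝ), ∫⁻ x : V, f (x, t) := by
  have : upperHalf V = univ ×ˢ Ioi (0 : ℝ) := by ext; simp [upperHalf]
  rw [this, Measure.volume_eq_prod, ← Measure.prod_restrict, Measure.restrict_univ,
    lintegral_prod_symm _ hf.aemeasurable]

section

variable {V : Type*} [NormedAddCommGroup V] [NormedSpace ℝ V]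
    [FiniteDimensional ℝ V] [MeasureSpace V] [BorelSpace V]
    [(volume : Measure V).IsAddHaarMeasure]

/-- On each slice the shift by `t z` is a translation and disappears. Rescaling the height then
gives `m ^ α` from the weight and `m⁻¹` from the Jacobian. -/
theorem setLIntegral_upperHalf_comp {h : V × ℝ → ℝ≥0∞} (hh : Measurable h) (z : V) {m : ℝ}
    (hm : 0 < m) (α : ℝ) :
    ∫⁻ x in upperHalf V, h ((x.1, 0) + x.2 • (z, m)) * ENNReal.ofReal (x.2 ^ (-α)) =
      ENNReal.ofReal (m ^ (α - 1)) *
        ∫⁻ x in upperHalf V, h x * ENNReal.ofReal (x.2 ^ (-α)) := by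
  rw [setLIntegral_upperHalf (by fun_prop), setLIntegral_upperHalf (by fun_prop)]
  set G : ℝ → ℝ≥0∞ := fun t => ∫⁻ x : V, h (x, t) with hG
  have hGm : Measurable G := hh.lintegral_prod_left'
  have h1 (t : ℝ) : ∫⁻ x : V, h ((x, 0) + t • (z, m)) * ENNReal.ofReal (t ^ (-α)) =
      G (t * m) * ENNReal.ofReal (t ^ (-α)) := by
    rw [lintegral_mul_const _ (by fun_prop)]
    simp only [Prod.smul_mk, Prod.mk_add_mk, smul_eq_mul, zero_add, hG]
    rw [lintegral_add_right_eq_self (fun x => h (x, t * m))]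
  have h2 (t : ℝ) : ∫⁻ x : V, h (x, t) * ENNReal.ofReal (t ^ (-α)) =
      G t * ENNReal.ofReal (t ^ (-α)) := by
    rw [lintegral_mul_const _ (by fun_prop)]
  simp only [h1, h2]
  set K : ℝ → ℝ≥0∞ := (Ioi 0).indicator fun t => G t * ENNReal.ofReal (t ^ (-α)) with hK
  have hKm : Measurable K := (hGm.mul (by fun_prop)).indicator measurableSet_Ioi
  have h3 := lintegral_comp_add_smul volume hKm 0 hm
  rw [finrank_self, pow_one] at h3
  simp only [zero_add, smul_eq_mul] at h3
  rw [← lintegral_indicator measurableSet_Ioi, ← lintegral_indicator measurableSet_Ioi, ← hK]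
  have h4 : (fun t => (Ioi (0 : ℝ)).indicator
      (fun t => G (t * m) * ENNReal.ofReal (t ^ (-α))) t) =
      fun t => ENNReal.ofReal (m ^ α) * K (m * t) := by
    ext t
    by_cases ht : 0 < t
    · have : m * t ∈ Ioi 0 := mul_pos hm ht
      rw [hK, indicator_of_mem this, indicator_of_mem (mem_Ioi.2 ht), mul_comm t m,
        mul_left_comm, ← ENNReal.ofReal_mul (by positivity), Real.mul_rpow hm.le ht.le,
        ← mul_assoc, ← Real.rpow_add hm]
      simp
    · have : m * t ∉ Ioi 0 := fun h => ht (pos_of_mul_pos_right h hm.le)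
      rw [hK, indicator_of_notMem this, indicator_of_notMem (by simpa using ht), mul_zero]
  rw [h4, lintegral_const_mul _ (by fun_prop), h3, ← mul_assoc,
    ← ENNReal.ofReal_mul (by positivity), Real.rpow_sub hm, Real.rpow_one, div_eq_mul_inv]

/-- Dilate towards the boundary, absorb, and average over the dilations. Finiteness of the left side
is needed for the absorption only; the constant does not depend on it. -/
theorem hardy_upperHalf {p α κ : ℝ} (hp : 1 ≤ p) (hα : 1 < α) (hκ0 : 0 < κ) (hκ1 : κ < 1) :
    ∃ C : ℝ≥0, ∀ F : V × ℝ → ℝ, Measurable F →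
      ∫⁻ x in upperHalf V, ENNReal.ofReal (|F x| ^ p) * ENNReal.ofReal (x.2 ^ (-α)) ≠ ∞ →
      ∫⁻ x in upperHalf V, ENNReal.ofReal (|F x| ^ p) * ENNReal.ofReal (x.2 ^ (-α)) ≤
        C * ∫⁻ x in upperHalf V, ENNReal.ofReal (x.2 ^ (-(α + finrank ℝ (V × ℝ)))) *
          ∫⁻ y in Metric.ball x (κ * x.2), ENNReal.ofReal (|F y - F x| ^ p) := by
  set q : ℝ := (1 - κ / 2) ^ (α - 1) with hq
  have hq0 : 0 < q := Real.rpow_pos_of_pos (by linarith) _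
  have hq1 : q < 1 := Real.rpow_lt_one (by linarith) (by linarith) (by linarith)
  -- With this exponent `θ ^ (1 - p) * q = q ^ (1 / (2 * p) + 1 / 2)`, which is below 1 for every `p
  -- ≥ 1`.
  set θ : ℝ := q ^ (1 / (2 * p)) with hθ
  have hp0 : 0 < p := by linarith
  have hθ0 : 0 < θ := Real.rpow_pos_of_pos hq0 _
  have hθ1 : θ < 1 := Real.rpow_lt_one hq0.le hq1 (by positivity)
  have hA : θ ^ (1 - p) * q < 1 := by
    have : θ ^ (1 - p) * q = q ^ (1 / (2 * p) * (1 - p) + 1) := by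
      rw [Real.rpow_add hq0, Real.rpow_one, hθ, ← Real.rpow_mul hq0.le]
    rw [this]
    apply Real.rpow_lt_one hq0.le hq1
    have : 1 / (2 * p) * (1 - p) + 1 = 1 / (2 * p) + 1 / 2 := by field_simp; ring
    rw [this]; positivity
  set A : ℝ := θ ^ (1 - p) * q with hAd
  set B : ℝ := (1 - θ) ^ (1 - p) with hB
  have hB0 : 0 < B := Real.rpow_pos_of_pos (by linarith) _
  have hA0 : 0 < A := by positivity
  -- The parameters `(z, m)`: close enough to `(0, 1)` for the image of `x` to stay in the ball of
  -- radius `κ * x.2`, with `m` bounded away from 1 for a uniform contraction factor `q`.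
  set Q : Set (V × ℝ) := Metric.ball 0 κ ×ˢ Ioo (1 - κ) (1 - κ / 2) with hQ
  have hQm : MeasurableSet Q := Metric.isOpen_ball.measurableSet.prod measurableSet_Ioo
  have hQo : IsOpen Q := Metric.isOpen_ball.prod isOpen_Ioo
  have hQb : Bornology.IsBounded Q := Metric.isBounded_ball.prod (Metric.isBounded_Ioo _ _)
  have hv0 : volume Q ≠ 0 := by
    refine (hQo.measure_pos _ ⟨(0, 1 - 3 * κ / 4), ?_⟩).ne'
    refine ⟨by simpa using hκ0, ?_, ?_⟩ <;> simp only <;> linarith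
  have hv1 : volume Q ≠ ∞ := hQb.measure_lt_top.ne
  refine ⟨((volume Q)⁻¹).toNNReal * (B / (1 - A)).toNNReal, fun F hF hI => ?_⟩
  rw [ENNReal.coe_mul, ENNReal.coe_toNNReal (ENNReal.inv_ne_top.2 hv0)]
  set I := ∫⁻ x in upperHalf V, ENNReal.ofReal (|F x| ^ p) * ENNReal.ofReal (x.2 ^ (-α)) with hId
  set J : V × ℝ → ℝ≥0∞ := fun w => ∫⁻ x in upperHalf V,
    ENNReal.ofReal (|F ((x.1, 0) + x.2 • w) - F x| ^ p) * ENNReal.ofReal (x.2 ^ (-α)) with hJ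
  have step1 (w : V × ℝ) (hw : w ∈ Q) : I ≤ ENNReal.ofReal (B / (1 - A)) * J w := by
    obtain ⟨z, m⟩ := w
    obtain ⟨-, hm1, hm2⟩ := hw
    simp only at hm1 hm2
    have hm0 : 0 < m := by linarith
    have h1 : I ≤ ENNReal.ofReal A * I + ENNReal.ofReal B * J (z, m) := by
      calc I ≤ ∫⁻ x in upperHalf V, (ENNReal.ofReal (θ ^ (1 - p)) *
            (ENNReal.ofReal (|F ((x.1, 0) + x.2 • (z, m))| ^ p) * ENNReal.ofReal (x.2 ^ (-α))) +
            ENNReal.ofReal B * (ENNReal.ofReal (|F ((x.1, 0) + x.2 • (z, m)) - F x| ^ p) *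
              ENNReal.ofReal (x.2 ^ (-α)))) := by
            refine lintegral_mono fun x => ?_
            rw [← mul_assoc, ← mul_assoc, ← add_mul]
            gcongr
            rw [← ENNReal.ofReal_mul (by positivity), ← ENNReal.ofReal_mul hB0.le,
              ← ENNReal.ofReal_add (by positivity) (by positivity)]
            exact ENNReal.ofReal_le_ofReal (abs_rpow_le_add hp hθ0 hθ1 _ _)
        _ = ENNReal.ofReal (θ ^ (1 - p)) * (ENNReal.ofReal (m ^ (α - 1)) * I) +
            ENNReal.ofReal B * J (z, m) := by
            rw [lintegral_add_left (by fun_prop), lintegral_const_mul _ (by fun_prop),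
              lintegral_const_mul _ (by fun_prop),
              setLIntegral_upperHalf_comp (h := fun x => ENNReal.ofReal (|F x| ^ p)) (by fun_prop)
                z hm0 α]
        _ ≤ _ := by
            rw [← mul_assoc, ← ENNReal.ofReal_mul (by positivity)]
            gcongr
            rw [hAd]
            refine mul_le_mul_of_nonneg_left ?_ (by positivity)
            exact Real.rpow_le_rpow hm0.le hm2.le (by linarith)
    by_cases hJt : J (z, m) = ∞
    · rw [hJt, ENNReal.mul_top]
      · exact le_top
      · simpa using div_pos hB0 (by linarith)
    lift I to ℝ≥0 using hI with I'
    lift J (z, m) to ℝ≥0 using hJt with J'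
    have h2 : (I' : ℝ) ≤ A * I' + B * J' := by
      rw [← ENNReal.ofReal_coe_nnreal, ← ENNReal.ofReal_coe_nnreal (p := J'),
        ← ENNReal.ofReal_mul hA0.le, ← ENNReal.ofReal_mul hB0.le,
        ← ENNReal.ofReal_add (by positivity) (by positivity)] at h1
      exact (ENNReal.ofReal_le_ofReal_iff (by positivity)).1 h1
    rw [← ENNReal.ofReal_coe_nnreal, ← ENNReal.ofReal_coe_nnreal (p := J'),
        ← ENNReal.ofReal_mul (div_nonneg hB0.le (by linarith))]
    apply ENNReal.ofReal_le_ofReal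
    rw [div_mul_eq_mul_div, le_div_iff₀ (by linarith)]
    linarith
  have hmeas : Measurable fun z : (V × ℝ) × (V × ℝ) =>
      ENNReal.ofReal (|F ((z.2.1, 0) + z.2.2 • z.1) - F z.2| ^ p) *
        ENNReal.ofReal (z.2.2 ^ (-α)) := by fun_prop
  have step2 : volume Q * I ≤ ENNReal.ofReal (B / (1 - A)) * ∫⁻ w in Q, J w := by
    rw [mul_comm, ← setLIntegral_const, ← lintegral_const_mul _ hmeas.lintegral_prod_right']
    exact setLIntegral_mono' hQm step1
  have step3 : ∫⁻ w in Q, J w ≤ ∫⁻ x in upperHalf V,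
      ENNReal.ofReal (x.2 ^ (-(α + finrank ℝ (V × ℝ)))) *
          ∫⁻ y in Metric.ball x (κ * x.2), ENNReal.ofReal (|F y - F x| ^ p) := by
    rw [hJ, lintegral_lintegral_swap hmeas.aemeasurable]
    refine setLIntegral_mono' measurableSet_upperHalf fun x (hx : 0 < x.2) => ?_
    rw [lintegral_mul_const _ (by fun_prop)]
    set g : V × ℝ → ℝ≥0∞ := (Metric.ball x (κ * x.2)).indicator
      fun y => ENNReal.ofReal (|F y - F x| ^ p) with hg
    have hgm : Measurable g := Measurable.indicator (by fun_prop) Metric.isOpen_ball.measurableSet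
    have h1 : ∫⁻ w in Q, ENNReal.ofReal (|F ((x.1, 0) + x.2 • w) - F x| ^ p) ≤
        ∫⁻ w, g ((x.1, 0) + x.2 • w) := by
      refine le_trans (setLIntegral_mono' hQm fun w hw => ?_) (setLIntegral_le_lintegral Q _)
      obtain ⟨hz, hm1, hm2⟩ := hw
      rw [hg, indicator_of_mem]
      rw [Metric.mem_ball, Prod.dist_eq, max_lt_iff]
      constructor
      · simp only [Prod.fst_add, Prod.smul_fst, dist_self_add_left, norm_smul, Real.norm_eq_abs,
          abs_of_pos hx]
        rw [mul_comm]
        gcongr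
        simpa using hz
      · simp only [Prod.snd_add, Prod.smul_snd, smul_eq_mul, zero_add, Real.dist_eq, abs_lt]
        constructor <;> nlinarith
    have : (volume : Measure (V × ℝ)).IsAddHaarMeasure :=
      inferInstanceAs ((volume : Measure V).prod (volume : Measure ℝ)).IsAddHaarMeasure
    rw [lintegral_comp_add_smul volume hgm _ hx, hg,
      lintegral_indicator Metric.isOpen_ball.measurableSet] at h1
    -- The extra power `-finrank` of the height is the Jacobian of `w ↦ (x.1, 0) + x.2 • w`.
    rw [neg_add, Real.rpow_add hx, mul_comm (x.2 ^ (-α)), ENNReal.ofReal_mul (by positivity),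
      mul_right_comm, Real.rpow_neg hx.le (finrank ℝ (V × ℝ) : ℝ), Real.rpow_natCast]
    gcongr
  calc I = (volume Q)⁻¹ * (volume Q * I) := by
        rw [← mul_assoc, ENNReal.inv_mul_cancel hv0 hv1, one_mul]
    _ ≤ _ := by
        rw [mul_assoc]
        exact mul_le_mul_right (step2.trans (mul_le_mul_right step3 _)) _

end

/-! ### Flattening charts -/

/-- The shear `(x', t) ↦ (x', t - ζ x')`. -/
def shearEquiv {V : Type*} [MeasurableSpace V] (ζ : V → ℝ) (hζ : Measurable ζ) :
    V × ℝ ≃ᵐ V × ℝ where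
  toFun x := (x.1, x.2 - ζ x.1)
  invFun x := (x.1, x.2 + ζ x.1)
  left_inv x := by simp
  right_inv x := by simp
  measurable_toFun := by
    change Measurable fun x : V × ℝ => (x.1, x.2 - ζ x.1)
    fun_prop
  measurable_invFun := by
    change Measurable fun x : V × ℝ => (x.1, x.2 + ζ x.1)
    fun_prop

theorem measurePreserving_shearEquiv {V : Type*} [MeasureSpace V] [SFinite (volume : Measure V)]
    (ζ : V → ℝ) (hζ : Measurable ζ) : MeasurePreserving (shearEquiv ζ hζ) := by
  refine MeasurePreserving.skew_product (g := fun a b => b - ζ a) (MeasurePreserving.id _)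
    (by unfold Function.uncurry; fun_prop) (ae_of_all _ fun a => ?_)
  exact (measurePreserving_sub_right volume (ζ a)).map_eq

theorem dist_shear_le {V : Type*} [PseudoMetricSpace V] {ζ : V → ℝ} {L : ℝ≥0}
    (hζ : LipschitzWith L ζ) (x y : V × ℝ) :
    dist ((x.1, x.2 - ζ x.1) : V × ℝ) (y.1, y.2 - ζ y.1) ≤ (1 + L) * dist x y := by
  have h1 : dist x.1 y.1 ≤ dist x y := le_max_left _ _
  have h2 : dist x.2 y.2 ≤ dist x y := le_max_right _ _
  have h3 := hζ.dist_le_mul x.1 y.1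
  have h4 : (L : ℝ) * dist x.1 y.1 ≤ L * dist x y := by gcongr
  have h0 : 0 ≤ L * dist x y := by positivity
  rw [Prod.dist_eq]
  refine max_le (by simp only; linarith) ?_
  have := dist_sub_sub_le x.2 (ζ x.1) y.2 (ζ y.1)
  simp only
  linarith

theorem dist_unshear_le {V : Type*} [PseudoMetricSpace V] {ζ : V → ℝ} {L : ℝ≥0}
    (hζ : LipschitzWith L ζ) (x y : V × ℝ) :
    dist x y ≤ (1 + L) * dist ((x.1, x.2 - ζ x.1) : V × ℝ) (y.1, y.2 - ζ y.1) := by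
  have h : LipschitzWith L (fun x => -ζ x) := hζ.neg
  simpa using dist_shear_le h (x.1, x.2 - ζ x.1) (y.1, y.2 - ζ y.1)

/-- By Mazur–Ulam, an isometry is a linear isometry followed by a translation. -/
theorem IsometryEquiv.measurePreserving {E F : Type*} [NormedAddCommGroup E]
    [InnerProductSpace ℝ E] [FiniteDimensional ℝ E] [MeasurableSpace E] [BorelSpace E]
    [NormedAddCommGroup F] [InnerProductSpace ℝ F] [FiniteDimensional ℝ F] [MeasurableSpace F]
    [BorelSpace F] (e : E ≃ᵢ F) : MeasurePreserving e := by
  have h := (measurePreserving_add_right (volume : Measure F) (e 0)).comp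
    e.toRealLinearIsometryEquiv.measurePreserving
  have he : (fun x => x + e 0) ∘ e.toRealLinearIsometryEquiv = e := by
    funext x
    simp
  rwa [he] at h

/-- A rigid motion followed by the shear preserves volume, so no Jacobian enters later. The factor 2
in `M = 2 * (1 + L)` pays for replacing the Euclidean distance on the product by the sup distance.
-/
theorem IsRigidLipschitzHypograph.exists_chart {d : ℕ} {D : Set (EuclideanSpace ℝ (Fin d))}
    (hD : IsRigidLipschitzHypograph D) :
    ∃ (Ψ : EuclideanSpace ℝ (Fin d) ≃ᵐ EuclideanSpace ℝ (Fin (d - 1)) × ℝ) (M : ℝ), 1 ≤ M ∧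
      MeasurePreserving Ψ ∧ (∀ x y, dist (Ψ x) (Ψ y) ≤ M * dist x y) ∧
      (∀ x y, dist x y ≤ M * dist (Ψ x) (Ψ y)) ∧ D = Ψ ⁻¹' upperHalf _ := by
  obtain ⟨e, ζ, L, hζ, rfl⟩ := hD
  have hζm : Measurable ζ := hζ.continuous.measurable
  refine ⟨(e.toHomeomorph.toMeasurableEquiv.trans (MeasurableEquiv.toLp 2 _).symm).trans
    (shearEquiv ζ hζm), 2 * (1 + L), ?_, ?_, fun x y => ?_, fun x y => ?_, ?_⟩
  · have : (0 : ℝ) ≤ L := L.2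
    linarith
  · have h := (measurePreserving_shearEquiv ζ hζm).comp
      ((WithLp.volume_preserving_ofLp (EuclideanSpace ℝ (Fin (d - 1))) ℝ).comp
        (IsometryEquiv.measurePreserving e))
    exact h
  · change dist (((e x).ofLp.1, (e x).ofLp.2 - ζ (e x).ofLp.1) : _ × ℝ)
      ((e y).ofLp.1, (e y).ofLp.2 - ζ (e y).ofLp.1) ≤ _
    have h1 := (WithLp.prod_lipschitzWith_ofLp 2 (EuclideanSpace ℝ (Fin (d - 1))) ℝ).dist_le_mul
      (e x) (e y)
    have h2 := dist_shear_le hζ (e x).ofLp (e y).ofLp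
    rw [e.dist_eq, NNReal.coe_one, one_mul] at h1
    have h3 : (1 + (L : ℝ)) * dist (e x).ofLp (e y).ofLp ≤ (1 + L) * dist x y := by gcongr
    have : 0 ≤ (1 + (L : ℝ)) * dist x y := by positivity
    linarith
  · change _ ≤ 2 * (1 + (L : ℝ)) * dist (((e x).ofLp.1, (e x).ofLp.2 - ζ (e x).ofLp.1) : _ × ℝ)
      ((e y).ofLp.1, (e y).ofLp.2 - ζ (e y).ofLp.1)
    have h1 := (WithLp.prod_antilipschitzWith_ofLp 2
      (EuclideanSpace ℝ (Fin (d - 1))) ℝ).le_mul_dist (e x) (e y)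
    have h2 := dist_unshear_le hζ (e x).ofLp (e y).ofLp
    rw [e.dist_eq] at h1
    rw [mul_assoc]
    refine h1.trans (mul_le_mul ?_ h2 dist_nonneg (by norm_num))
    have : ((2 : ℝ≥0) ^ (1 / (2 : ℝ≥0∞)).toReal : ℝ≥0) ≤ 2 ^ (1 : ℝ) := by
      apply NNReal.rpow_le_rpow_of_exponent_le (by norm_num)
      norm_num
    simpa using NNReal.coe_le_coe.2 this
  · ext x
    simp only [mem_preimage, upperHalf, mem_ofPred_eq]
    exact sub_pos.symm

/-! ### The boundary distance -/

/-- The ball is connected and misses the frontier, so it cannot leave `Ω`. -/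
theorem ball_bdryDist_subset {d : ℕ} {Ω : Set (EuclideanSpace ℝ (Fin d))} (hΩ : IsOpen Ω)
    {x : EuclideanSpace ℝ (Fin d)} (hx : x ∈ Ω) : Metric.ball x (bdryDist Ω x) ⊆ Ω := by
  rcases le_or_gt (bdryDist Ω x) 0 with h | h
  · rw [Metric.ball_eq_empty.2 h]; exact empty_subset _
  refine (convex_ball x _).isPreconnected.subset_left_of_subset_union (v := (closure Ω)ᶜ) hΩ
    isClosed_closure.isOpen_compl ?_ ?_ ⟨x, Metric.mem_ball_self h, hx⟩
  · exact disjoint_compl_right.mono_left subset_closure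
  · intro y hy
    by_contra hn
    simp only [mem_union, mem_compl_iff, not_or, not_not] at hn
    have : y ∈ frontier Ω := by rw [hΩ.frontier_eq]; exact ⟨hn.2, hn.1⟩
    exact absurd (Metric.infDist_le_dist_of_mem this) (not_le.2 (by rwa [dist_comm]))

theorem bdryDist_nonneg {d : ℕ} (Ω : Set (EuclideanSpace ℝ (Fin d)))
    (x : EuclideanSpace ℝ (Fin d)) : 0 ≤ bdryDist Ω x := Metric.infDist_nonneg

@[fun_prop]
theorem continuous_bdryDist {d : ℕ} (Ω : Set (EuclideanSpace ℝ (Fin d))) :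
    Continuous (bdryDist Ω) := Metric.continuous_infDist_pt _

@[fun_prop]
theorem measurable_bdryDist {d : ℕ} (Ω : Set (EuclideanSpace ℝ (Fin d))) :
    Measurable (bdryDist Ω) := (continuous_bdryDist Ω).measurable

theorem exists_bdryDist_le {d : ℕ} {Ω : Set (EuclideanSpace ℝ (Fin d))}
    (hΩ : Bornology.IsBounded Ω) : ∃ R : ℝ, 0 < R ∧ ∀ x ∈ Ω, bdryDist Ω x ≤ R := by
  obtain ⟨R, hR⟩ := hΩ.isCompact_closure.exists_bound_of_continuousOn
    (continuous_bdryDist Ω).continuousOn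
  refine ⟨max R 1, by positivity, fun x hx => ?_⟩
  exact (le_abs_self _).trans ((hR x (subset_closure hx)).trans (le_max_left _ _))

/-! ### The energy and multiplication by Lipschitz functions -/

section energy

variable {d : ℕ} {s p : ℝ} {Ω : Set (EuclideanSpace ℝ (Fin d))}

/-- The `p`-th power of the full norm. -/
def energy {d : ℕ} (s p : ℝ) (Ω : Set (EuclideanSpace ℝ (Fin d)))
    (u : EuclideanSpace ℝ (Fin d) → ℝ) : ℝ≥0∞ :=
  (∫⁻ x in Ω, ENNReal.ofReal (|u x| ^ p)) + seminormPow s p Ω u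

theorem fullNorm_eq (hp : 1 ≤ p) (u : EuclideanSpace ℝ (Fin d) → ℝ) :
    fullNorm s p Ω u = energy s p Ω u ^ (1 / p) := by
  have hp0 : 0 < p := by linarith
  rw [fullNorm, energy, eLpNorm_eq_lintegral_rpow_enorm_toReal (by simpa using hp0) (by simp),
    ENNReal.toReal_ofReal hp0.le, ← ENNReal.rpow_mul, one_div_mul_cancel hp0.ne', ENNReal.rpow_one]
  congr 3
  ext x
  rw [← ENNReal.ofReal_rpow_of_nonneg (abs_nonneg _) hp0.le, Real.enorm_eq_ofReal_abs]

theorem fullNorm_rpow (hp : 1 ≤ p) (u : EuclideanSpace ℝ (Fin d) → ℝ) :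
    fullNorm s p Ω u ^ p = energy s p Ω u := by
  rw [fullNorm_eq hp, ← ENNReal.rpow_mul, one_div_mul_cancel (by linarith), ENNReal.rpow_one]

theorem energy_congr {u v : EuclideanSpace ℝ (Fin d) → ℝ} (h : u =ᵐ[volume.restrict Ω] v) :
    energy s p Ω u = energy s p Ω v := by
  unfold energy seminormPow
  congr 1
  · refine lintegral_congr_ae ?_
    filter_upwards [h] with x hx
    rw [hx]
  · refine lintegral_congr_ae ?_
    filter_upwards [h] with x hx
    refine lintegral_congr_ae ?_
    filter_upwards [ae_restrict_of_ae_restrict_of_subset inter_subset_left h] with y hy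
    rw [hx, hy]

/-- The pairs `(x, y)` over which the seminorm integrates. -/
def pairSet {d : ℕ} (Ω : Set (EuclideanSpace ℝ (Fin d))) :
    Set (EuclideanSpace ℝ (Fin d) × EuclideanSpace ℝ (Fin d)) :=
  {z | z.1 ∈ Ω ∧ z.2 ∈ Ω ∧ dist z.2 z.1 < bdryDist Ω z.1}

theorem measurableSet_pairSet (hΩ : IsOpen Ω) : MeasurableSet (pairSet Ω) :=
  (measurable_fst hΩ.measurableSet).inter ((measurable_snd hΩ.measurableSet).inter
    (measurableSet_lt (measurable_snd.dist measurable_fst)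
      ((measurable_bdryDist Ω).comp measurable_fst)))

/-- As one integral over a measurable set of pairs, the seminorm has a visibly measurable integrand,
so additivity of the integral applies in `energy_add_le`. -/
theorem seminormPow_eq (hΩ : IsOpen Ω) {u : EuclideanSpace ℝ (Fin d) → ℝ} (hu : Measurable u) :
    seminormPow s p Ω u = ∫⁻ z in pairSet Ω,
      ENNReal.ofReal (|u z.2 - u z.1| ^ p / bdryDist Ω z.1 ^ ((d : ℝ) + p * s)) := by
  rw [← lintegral_indicator (measurableSet_pairSet hΩ), Measure.volume_eq_prod,
    lintegral_prod _ (Measurable.indicator (by fun_prop) (measurableSet_pairSet hΩ)).aemeasurable,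
    seminormPow, ← lintegral_indicator hΩ.measurableSet]
  congr 1
  ext x
  by_cases hx : x ∈ Ω
  · rw [indicator_of_mem hx,
      ← lintegral_indicator (hΩ.measurableSet.inter Metric.isOpen_ball.measurableSet)]
    congr 1
    ext y
    by_cases hy : y ∈ Ω ∩ Metric.ball x (bdryDist Ω x)
    · have hz : (x, y) ∈ pairSet Ω := ⟨hx, hy.1, hy.2⟩
      rw [indicator_of_mem hy, indicator_of_mem hz]
    · have hz : (x, y) ∉ pairSet Ω := fun h => hy ⟨h.2.1, h.2.2⟩
      rw [indicator_of_notMem hy, indicator_of_notMem hz]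
  · simp [indicator, pairSet, hx]

theorem energy_add_le (hp : 1 ≤ p) (hΩ : IsOpen Ω) {u v : EuclideanSpace ℝ (Fin d) → ℝ}
    (hu : Measurable u) (hv : Measurable v) :
    energy s p Ω (u + v) ≤ ENNReal.ofReal (2 ^ p) * (energy s p Ω u + energy s p Ω v) := by
  unfold energy
  rw [seminormPow_eq hΩ hu, seminormPow_eq hΩ hv, seminormPow_eq hΩ (hu.add hv), add_add_add_comm,
    mul_add]
  gcongr
  · rw [← lintegral_add_left (by fun_prop), ← lintegral_const_mul _ (by fun_prop)]
    refine lintegral_mono fun x => ?_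
    rw [← ENNReal.ofReal_add (by positivity) (by positivity),
      ← ENNReal.ofReal_mul (by positivity)]
    exact ENNReal.ofReal_le_ofReal (abs_add_rpow_le hp _ _)
  · rw [← lintegral_add_left (by fun_prop), ← lintegral_const_mul _ (by fun_prop)]
    refine lintegral_mono fun z => ?_
    have h0 := bdryDist_nonneg Ω z.1
    rw [← ENNReal.ofReal_add (by positivity) (by positivity),
      ← ENNReal.ofReal_mul (by positivity), ← add_div, ← mul_div_assoc]
    refine ENNReal.ofReal_le_ofReal (div_le_div_of_nonneg_right ?_ (by positivity))
    have := abs_add_rpow_le hp (u z.2 - u z.1) (v z.2 - v z.1)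
    rwa [sub_add_sub_comm] at this

/-- The ball has volume of order `δ ^ d`, leaving `δ ^ (p - p * s)`, a nonnegative power because `s
≤ 1`. If `δ = 0` the ball is empty. -/
theorem setLIntegral_ball_bdryDist_le (hp : 1 ≤ p) (hs : s ≤ 1) {R : ℝ}
    {x : EuclideanSpace ℝ (Fin d)} (hx : bdryDist Ω x ≤ R) :
    ∫⁻ _ in Ω ∩ Metric.ball x (bdryDist Ω x),
      ENNReal.ofReal (bdryDist Ω x ^ p / bdryDist Ω x ^ ((d : ℝ) + p * s)) ≤
      ENNReal.ofReal (R ^ (p - p * s)) *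
        volume (Metric.ball (0 : EuclideanSpace ℝ (Fin d)) 1) := by
  rcases (bdryDist_nonneg Ω x).eq_or_lt' with h | h
  · simp [h]
  rw [setLIntegral_const]
  calc _ ≤ ENNReal.ofReal (bdryDist Ω x ^ p / bdryDist Ω x ^ ((d : ℝ) + p * s)) *
        volume (Metric.ball x (bdryDist Ω x)) := by gcongr; exact inter_subset_right
    _ = ENNReal.ofReal (bdryDist Ω x ^ (p - p * s)) *
        volume (Metric.ball (0 : EuclideanSpace ℝ (Fin d)) 1) := by
      rw [Measure.addHaar_ball_of_pos _ _ h, ← mul_assoc, ← ENNReal.ofReal_mul (by positivity),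
        finrank_euclideanSpace, Fintype.card_fin]
      congr 2
      rw [Real.rpow_add h, Real.rpow_sub h, Real.rpow_natCast]
      field_simp
    _ ≤ _ := by
      gcongr
      nlinarith

theorem abs_mul_sub_mul_rpow_le (hp : 1 ≤ p) {a b g h B k : ℝ} (ha : |a| ≤ B)
    (hab : |a - b| ≤ k) :
    |a * g - b * h| ^ p ≤ 2 ^ p * (B ^ p * |g - h| ^ p + k ^ p * |h| ^ p) := by
  have hp0 : 0 ≤ p := by linarith
  have h1 := abs_add_rpow_le hp (a * (g - h)) ((a - b) * h)
  rw [show a * (g - h) + (a - b) * h = a * g - b * h by ring, abs_mul, abs_mul,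
    Real.mul_rpow (abs_nonneg _) (abs_nonneg _), Real.mul_rpow (abs_nonneg _) (abs_nonneg _)] at h1
  refine h1.trans ?_
  gcongr

/-- Split `χ y * g y - χ x * g x` as `χ y * (g y - g x) + (χ y - χ x) * g x`. The second term is at
most `K * δ(x) * |g x|`, and its integral over `y` is controlled by `setLIntegral_ball_bdryDist_le`.
-/
theorem exists_energy_mul_le (hp : 1 ≤ p) (hs : s ≤ 1) (hΩ : IsOpen Ω)
    (hΩb : Bornology.IsBounded Ω) {χ : EuclideanSpace ℝ (Fin d) → ℝ}
    {K : ℝ≥0} (hχ : LipschitzWith K χ) :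
    ∃ C : ℝ≥0, ∀ g : EuclideanSpace ℝ (Fin d) → ℝ, Measurable g →
      energy s p Ω (fun x => χ x * g x) ≤ C * energy s p Ω g := by
  have hp0 : 0 < p := by linarith
  obtain ⟨R, hR0, hR⟩ := exists_bdryDist_le hΩb
  obtain ⟨B, hB⟩ := hΩb.isCompact_closure.exists_bound_of_continuousOn hχ.continuous.continuousOn
  replace hB (x) (hx : x ∈ Ω) : |χ x| ≤ max B 0 :=
    (hB x (subset_closure hx)).trans (le_max_left _ _)
  have hB0 : 0 ≤ max B 0 := le_max_right _ _
  generalize max B 0 = B at hB hB0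
  set C0 : ℝ≥0∞ := ENNReal.ofReal (R ^ (p - p * s)) *
    volume (Metric.ball (0 : EuclideanSpace ℝ (Fin d)) 1) with hC0
  have hC0t : C0 ≠ ∞ :=
    ENNReal.mul_ne_top ENNReal.ofReal_ne_top Metric.isBounded_ball.measure_lt_top.ne
  set C1 : ℝ≥0∞ := ENNReal.ofReal (B ^ p) + ENNReal.ofReal (2 ^ p * K ^ p) * C0 with hC1
  set C2 : ℝ≥0∞ := ENNReal.ofReal (2 ^ p * B ^ p) with hC2
  have hC1t : C1 ≠ ∞ :=
    ENNReal.add_ne_top.2 ⟨ENNReal.ofReal_ne_top, ENNReal.mul_ne_top ENNReal.ofReal_ne_top hC0t⟩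
  refine ⟨(C1 + C2).toNNReal, fun g hg => ?_⟩
  rw [ENNReal.coe_toNNReal (ENNReal.add_ne_top.2 ⟨hC1t, ENNReal.ofReal_ne_top⟩)]
  have hL : ∫⁻ x in Ω, ENNReal.ofReal (|χ x * g x| ^ p) ≤
      ENNReal.ofReal (B ^ p) * ∫⁻ x in Ω, ENNReal.ofReal (|g x| ^ p) := by
    rw [← lintegral_const_mul _ (by fun_prop)]
    refine setLIntegral_mono' hΩ.measurableSet fun x hx => ?_
    rw [← ENNReal.ofReal_mul (by positivity), abs_mul,
      Real.mul_rpow (abs_nonneg _) (abs_nonneg _)]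
    gcongr
    exact hB x hx
  have hS : seminormPow s p Ω (fun x => χ x * g x) ≤ C2 * seminormPow s p Ω g +
      ENNReal.ofReal (2 ^ p * K ^ p) * C0 * ∫⁻ x in Ω, ENNReal.ofReal (|g x| ^ p) := by
    rw [seminormPow, ← lintegral_const_mul _ (by fun_prop)]
    have hgm : Measurable fun x => ENNReal.ofReal (2 ^ p * K ^ p) * C0 *
      ENNReal.ofReal (|g x| ^ p) := by fun_prop
    rw [seminormPow, ← lintegral_const_mul' _ _ ENNReal.ofReal_ne_top, ← lintegral_add_right _ hgm]
    refine setLIntegral_mono' hΩ.measurableSet fun x hx => ?_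
    have h0 := bdryDist_nonneg Ω x
    calc _ ≤ ∫⁻ y in Ω ∩ Metric.ball x (bdryDist Ω x),
          (C2 * ENNReal.ofReal (|g y - g x| ^ p / bdryDist Ω x ^ ((d : ℝ) + p * s)) +
          ENNReal.ofReal (2 ^ p * K ^ p) * ENNReal.ofReal (|g x| ^ p) *
            ENNReal.ofReal (bdryDist Ω x ^ p / bdryDist Ω x ^ ((d : ℝ) + p * s))) := by
          refine setLIntegral_mono' (hΩ.measurableSet.inter Metric.isOpen_ball.measurableSet)
            fun y hy => ?_
          rw [hC2, ← ENNReal.ofReal_mul (by positivity), ← ENNReal.ofReal_mul (by positivity),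
            ← ENNReal.ofReal_mul (by positivity), ← ENNReal.ofReal_add (by positivity)
            (by positivity), ← mul_div_assoc, ← mul_div_assoc, ← add_div]
          refine ENNReal.ofReal_le_ofReal (div_le_div_of_nonneg_right ?_ (by positivity))
          have hk : |χ y - χ x| ≤ K * bdryDist Ω x := by
            refine (hχ.dist_le_mul y x).trans ?_
            gcongr
            exact (Metric.mem_ball.1 hy.2).le
          have := abs_mul_sub_mul_rpow_le hp (g := g y) (h := g x) (hB y hy.1) hk
          rw [Real.mul_rpow K.coe_nonneg h0] at this
          linarith
      _ = C2 * (∫⁻ y in Ω ∩ Metric.ball x (bdryDist Ω x),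
            ENNReal.ofReal (|g y - g x| ^ p / bdryDist Ω x ^ ((d : ℝ) + p * s))) +
          ENNReal.ofReal (2 ^ p * K ^ p) * ENNReal.ofReal (|g x| ^ p) *
            ∫⁻ _ in Ω ∩ Metric.ball x (bdryDist Ω x),
            ENNReal.ofReal (bdryDist Ω x ^ p / bdryDist Ω x ^ ((d : ℝ) + p * s)) := by
          rw [lintegral_add_right _ measurable_const, lintegral_const_mul' _ _ ENNReal.ofReal_ne_top,
            lintegral_const_mul' _ _ (ENNReal.mul_ne_top ENNReal.ofReal_ne_top
              ENNReal.ofReal_ne_top)]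
      _ ≤ _ := by
          rw [mul_right_comm (ENNReal.ofReal (2 ^ p * K ^ p)) C0]
          gcongr
          exact setLIntegral_ball_bdryDist_le hp hs (hR x hx)
  unfold energy
  calc _ ≤ C1 * (∫⁻ x in Ω, ENNReal.ofReal (|g x| ^ p)) + C2 * seminormPow s p Ω g := by
        rw [hC1, add_mul, add_assoc, add_comm (_ * C0 * _)]
        exact add_le_add hL hS
    _ ≤ _ := by
        rw [mul_add]
        gcongr
        · exact le_self_add
        · exact le_add_self

theorem energy_lt_top_of_lipschitz (hp : 1 ≤ p) (hs : s ≤ 1) (hΩ : IsOpen Ω)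
    (hΩb : Bornology.IsBounded Ω) {φ : EuclideanSpace ℝ (Fin d) → ℝ}
    {K : ℝ≥0} (hφ : LipschitzWith K φ) : energy s p Ω φ < ∞ := by
  obtain ⟨C, hC⟩ := exists_energy_mul_le (s := s) hp hs hΩ hΩb hφ
  have h := hC (fun _ => 1) measurable_const
  simp only [mul_one] at h
  refine h.trans_lt (ENNReal.mul_lt_top ENNReal.coe_lt_top ?_)
  have hp0 : p ≠ 0 := by linarith
  simpa [energy, seminormPow, Real.zero_rpow hp0] using hΩb.measure_lt_top

end energy

/-! ### The local inequality near a boundary point -/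

theorem exists_lipschitz_cutoff {X : Type*} [PseudoMetricSpace X] (b : X) {r : ℝ} (hr : 0 < r) :
    ∃ (χ : X → ℝ) (K : ℝ≥0), LipschitzWith K χ ∧ (∀ x ∈ Metric.ball b r, χ x = 1) ∧
      ∀ x, x ∉ Metric.closedBall b (2 * r) → χ x = 0 := by
  have h1 : LipschitzWith (Real.toNNReal r⁻¹) (fun x => r⁻¹ * dist x b) := by
    refine LipschitzWith.of_dist_le_mul fun x y => ?_
    rw [Real.coe_toNNReal _ (by positivity), Real.dist_eq, ← mul_sub, abs_mul,
      abs_of_pos (inv_pos.2 hr)]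
    gcongr
    exact abs_dist_sub_le x y b
  have h2 : LipschitzWith (0 + Real.toNNReal r⁻¹) (fun x => 2 - r⁻¹ * dist x b) :=
    (LipschitzWith.const 2).sub h1
  refine ⟨fun x => max (min (2 - r⁻¹ * dist x b) 1) 0, _, (h2.min_const 1).max_const 0,
    fun x hx => ?_, fun x hx => ?_⟩
  · have : r⁻¹ * dist x b ≤ 1 := by
      rw [inv_mul_le_iff₀ hr, mul_one]; exact (Metric.mem_ball.1 hx).le
    simp only
    rw [min_eq_right (by linarith), max_eq_left zero_le_one]
  · have : 2 ≤ r⁻¹ * dist x b := by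
      rw [le_inv_mul_iff₀ hr, mul_comm]
      exact (not_le.1 hx).le
    exact max_eq_right ((min_le_left _ _).trans (by linarith))

variable {d : ℕ} {s p : ℝ} {Ω : Set (EuclideanSpace ℝ (Fin d))}

/-- Near a boundary point, the height over the graph is comparable with the boundary distance. -/
theorem height_comparable {V : Type*} [PseudoMetricSpace V]
    {O : Set (EuclideanSpace ℝ (Fin d))} {Ψ : EuclideanSpace ℝ (Fin d) ≃ V × ℝ}
    {M ρ : ℝ} (hM : 1 ≤ M)
    (hΨ : ∀ x y, dist (Ψ x) (Ψ y) ≤ M * dist x y) (hΨ' : ∀ x y, dist x y ≤ M * dist (Ψ x) (Ψ y))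
    (hΩ : IsOpen Ω) (hfc : IsCompact (frontier Ω)) (hO : Ω ∩ O = Ψ ⁻¹' upperHalf V ∩ O)
    {b : EuclideanSpace ℝ (Fin d)} (hb : b ∈ frontier Ω) (hρ : Metric.ball b ρ ⊆ O)
    {x : EuclideanSpace ℝ (Fin d)} (hx : x ∈ Ω) (hxb : dist x b < ρ / (2 * M ^ 2)) :
    (Ψ x).2 ≤ M * bdryDist Ω x ∧ bdryDist Ω x ≤ M * (Ψ x).2 := by
  have hd0 := dist_nonneg (x := x) (y := b)
  have hM2 : 1 ≤ M ^ 2 := one_le_pow₀ hM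
  have hxρ : M ^ 2 * dist x b < ρ / 2 := by
    rw [lt_div_iff₀ (by positivity)] at hxb; linarith
  have hxρ' : dist x b < ρ / 2 := by nlinarith
  have hxO : x ∈ O := hρ (Metric.mem_ball.2 (by linarith))
  have hxD : x ∈ Ψ ⁻¹' upperHalf V ∩ O := hO ▸ ⟨hx, hxO⟩
  have hx0 : 0 < (Ψ x).2 := hxD.1
  have h1 : (Ψ x).2 ≤ M * bdryDist Ω x := by
    -- A nearest boundary point still lies in `O` and is outside `Ω`, so its height is nonpositive.
    obtain ⟨c, hc, hxc⟩ := hfc.exists_infDist_eq_dist ⟨b, hb⟩ x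
    have hcx : dist x c ≤ dist x b := by
      rw [← hxc]; exact Metric.infDist_le_dist_of_mem hb
    have hcO : c ∈ O := by
      refine hρ (Metric.mem_ball.2 ?_)
      have := dist_triangle c x b
      rw [dist_comm c x] at this
      linarith
    have hcΩ : c ∉ Ω := by
      rw [hΩ.frontier_eq] at hc; exact hc.2
    have hc0 : (Ψ c).2 ≤ 0 := by
      by_contra h
      have : c ∈ Ω ∩ O := by rw [hO]; exact ⟨not_le.1 h, hcO⟩
      exact hcΩ this.1
    have h2 : dist (Ψ x).2 (Ψ c).2 ≤ dist (Ψ x) (Ψ c) := le_max_right _ _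
    have h3 := hΨ x c
    have h4 : (Ψ x).2 - (Ψ c).2 ≤ dist (Ψ x).2 (Ψ c).2 := le_abs_self _
    rw [bdryDist, hxc]
    linarith
  refine ⟨h1, ?_⟩
  have hδ : bdryDist Ω x ≤ dist x b := Metric.infDist_le_dist_of_mem hb
  -- The point of the graph below `x` lies outside `Ω`, hence outside the ball of radius `δ(x)`. The
  -- factor `2 * M ^ 2` in the radius keeps it inside `O`.
  set c := Ψ.symm ((Ψ x).1, 0) with hc
  have hxc : dist x c ≤ M * (Ψ x).2 := by
    have h2 := hΨ' x c
    have h3 : dist (Ψ x) (Ψ c) = (Ψ x).2 := by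
      rw [hc, Equiv.apply_symm_apply, Prod.dist_eq]
      simp [abs_of_pos hx0, hx0.le]
    rwa [h3] at h2
  have hcO : c ∈ O := by
    refine hρ (Metric.mem_ball.2 ?_)
    have := dist_triangle c x b
    rw [dist_comm c x] at this
    have : M * (Ψ x).2 ≤ M * (M * dist x b) := by gcongr; exact h1.trans (by gcongr)
    nlinarith
  have hcΩ : c ∉ Ω := by
    intro h
    have : c ∈ Ψ ⁻¹' upperHalf V ∩ O := hO ▸ ⟨h, hcO⟩
    have h0 : 0 < (Ψ c).2 := this.1
    rw [hc, Equiv.apply_symm_apply] at h0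
    exact lt_irrefl _ h0
  refine le_trans ?_ hxc
  by_contra h
  exact hcΩ (ball_bdryDist_subset hΩ hx (by rw [Metric.mem_ball, dist_comm]; exact not_le.1 h))

/-- Cut `φ` off near `b`, flatten, apply `hardy_upperHalf` with `α = p * s`, and transport both
sides back, trading height for `δ` at the cost of powers of `M`. -/
theorem exists_local_hardy (hp : 1 ≤ p) (hs : s ≤ 1) (hps : 1 < p * s) (hd : 1 ≤ d)
    (hΩ : IsOpen Ω) (hΩb : Bornology.IsBounded Ω) (hfc : IsCompact (frontier Ω))
    {O D : Set (EuclideanSpace ℝ (Fin d))} (hOo : IsOpen O) (hD : IsRigidLipschitzHypograph D)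
    (hOD : Ω ∩ O = D ∩ O) {b : EuclideanSpace ℝ (Fin d)} (hb : b ∈ frontier Ω) (hbO : b ∈ O) :
    ∃ (r : ℝ) (C : ℝ≥0), 0 < r ∧ ∀ φ, IsLipschitzCompactlySupportedIn Ω φ →
      ∫⁻ x in Ω ∩ Metric.ball b r, ENNReal.ofReal (|φ x| ^ p / bdryDist Ω x ^ (p * s)) ≤
        C * energy s p Ω φ := by
  obtain ⟨Ψ, M, hM, hΨm, hΨ, hΨ', rfl⟩ := hD.exists_chart
  obtain ⟨ρ, hρ0, hρ⟩ := Metric.isOpen_iff.1 hOo b hbO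
  have hp0 : 0 < p := by linarith
  have hM0 : 0 < M := by linarith
  have hM2 : 1 ≤ M ^ 2 := one_le_pow₀ hM
  set ρ1 : ℝ := ρ / (2 * M ^ 2) with hρ1
  have hρ10 : 0 < ρ1 := by positivity
  have hρ1ρ : ρ1 ≤ ρ := div_le_self hρ0.le (by linarith)
  -- Pulling back a ball of radius `κ` times the height loses at most `M ^ 2` relative to `δ(x)`, so
  -- it lands within distance `δ(x) / 2`.
  set κ : ℝ := 1 / (2 * M ^ 2) with hκ
  have hκ0 : 0 < κ := by positivity
  have hκM : M ^ 2 * κ = 1 / 2 := by rw [hκ]; field_simp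
  have hκ1 : κ ≤ 1 / 2 := by nlinarith
  obtain ⟨χ, K, hχ, hχ1, hχ0⟩ := exists_lipschitz_cutoff b (r := ρ1 / 4) (by positivity)
  obtain ⟨C1, hC1⟩ := exists_energy_mul_le (s := s) hp hs hΩ hΩb hχ
  obtain ⟨C2, hC2⟩ := hardy_upperHalf (V := EuclideanSpace ℝ (Fin (d - 1))) hp hps hκ0
    (show κ < 1 by linarith)
  have hfin : (finrank ℝ (EuclideanSpace ℝ (Fin (d - 1)) × ℝ) : ℝ) = d := by
    rw [finrank_prod, finrank_euclideanSpace, Fintype.card_fin, finrank_self, Nat.sub_add_cancel hd]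
  rw [hfin] at hC2
  have hΨc : Continuous Ψ :=
    (LipschitzWith.of_dist_le_mul (K := ⟨M, hM0.le⟩) hΨ).continuous
  have hcmp (x) (hx : x ∈ Ω) (hxb : dist x b < ρ1) :
      (Ψ x).2 ≤ M * bdryDist Ω x ∧ bdryDist Ω x ≤ M * (Ψ x).2 :=
    height_comparable (Ψ := Ψ.toEquiv) hM hΨ hΨ' hΩ hfc hOD hb hρ hx hxb
  have hball {x} (hxb : dist x b < ρ1) : x ∈ O := hρ (Metric.mem_ball.2 (by linarith))
  have hDm : MeasurableSet (Ψ ⁻¹' upperHalf (EuclideanSpace ℝ (Fin (d - 1)))) :=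
    Ψ.measurable measurableSet_upperHalf
  refine ⟨ρ1 / 4, (M ^ (p * s)).toNNReal * (C2 * ((M ^ (p * s + d)).toNNReal * C1)),
    by positivity, fun φ hφ => ?_⟩
  obtain ⟨⟨Kφ, hφL⟩, hφc, hφΩ⟩ := hφ
  set f : EuclideanSpace ℝ (Fin d) → ℝ := fun x => χ x * φ x with hf
  have hfcont : Continuous f := hχ.continuous.mul hφL.continuous
  have hf0 (x) (hx : f x ≠ 0) : dist x b ≤ ρ1 / 2 ∧ x ∈ tsupport φ := by
    constructor
    · by_contra h
      refine hx ?_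
      rw [hf]
      simp only
      rw [hχ0 x (by rw [Metric.mem_closedBall]; linarith), zero_mul]
    · exact subset_tsupport _ (right_ne_zero_of_mul hx)
  set F : EuclideanSpace ℝ (Fin (d - 1)) × ℝ → ℝ := fun x => f (Ψ.symm x) with hF
  have hFm : Measurable F := hfcont.measurable.comp Ψ.symm.measurable
  have transfer (g : EuclideanSpace ℝ (Fin (d - 1)) × ℝ → ℝ≥0∞) :
      ∫⁻ x in upperHalf _, g x = ∫⁻ x in Ψ ⁻¹' upperHalf _, g (Ψ x) :=
    (hΨm.setLIntegral_comp_preimage_emb Ψ.measurableEmbedding _ _).symm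
  have hfinite : ∫⁻ x in upperHalf _, ENNReal.ofReal (|F x| ^ p) *
      ENNReal.ofReal (x.2 ^ (-(p * s))) ≠ ∞ := by
    rw [transfer]
    simp only [hF, MeasurableEquiv.symm_apply_apply]
    -- The height is positive on this compact set, which contains every point where `f` is nonzero;
    -- so the weighted integrand is bounded there.
    set S := tsupport φ ∩ Metric.closedBall b (ρ1 / 2) with hS
    have hSc : IsCompact S := hφc.isCompact.inter_right Metric.isClosed_closedBall
    have hSpos (x) (hx : x ∈ S) : 0 < (Ψ x).2 := by
      have hxO : x ∈ O := hball (by have := Metric.mem_closedBall.1 hx.2; linarith)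
      have : x ∈ Ψ ⁻¹' upperHalf _ ∩ O := hOD ▸ ⟨hφΩ hx.1, hxO⟩
      exact this.1
    obtain ⟨B, hB⟩ := hSc.exists_bound_of_continuousOn (f := fun x => |f x| ^ p *
      (Ψ x).2 ^ (-(p * s))) (by
        refine ContinuousOn.mul (hfcont.abs.rpow_const fun _ => Or.inr hp0.le).continuousOn ?_
        exact (hΨc.snd.continuousOn).rpow_const fun x hx => Or.inl (hSpos x hx).ne')
    refine ne_top_of_le_ne_top (b := ∫⁻ x, S.indicator (fun _ => ENNReal.ofReal B) x) ?_ ?_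
    · rw [lintegral_indicator hSc.isClosed.measurableSet, setLIntegral_const]
      exact ENNReal.mul_ne_top ENNReal.ofReal_ne_top hSc.measure_lt_top.ne
    · refine (setLIntegral_le_lintegral _ _).trans (lintegral_mono fun x => ?_)
      by_cases hx : f x = 0
      · simp [hx, Real.zero_rpow hp0.ne']
      · obtain ⟨h1, h2⟩ := hf0 x hx
        have hxS : x ∈ S := ⟨h2, h1⟩
        rw [indicator_of_mem hxS, ← ENNReal.ofReal_mul (by positivity)]
        exact ENNReal.ofReal_le_ofReal ((le_abs_self _).trans (hB x hxS))
  have hH := hC2 F hFm hfinite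
  have hlow : ∫⁻ x in Ω ∩ Metric.ball b (ρ1 / 4),
      ENNReal.ofReal (|φ x| ^ p / bdryDist Ω x ^ (p * s)) ≤ ENNReal.ofReal (M ^ (p * s)) *
      ∫⁻ x in upperHalf _, ENNReal.ofReal (|F x| ^ p) * ENNReal.ofReal (x.2 ^ (-(p * s))) := by
    rw [transfer, ← lintegral_const_mul' _ _ ENNReal.ofReal_ne_top]
    simp only [hF, MeasurableEquiv.symm_apply_apply]
    have hsub {x} (hx : x ∈ Ω ∩ Metric.ball b (ρ1 / 4)) :
        x ∈ Ψ ⁻¹' upperHalf _ ∧ dist x b < ρ1 := by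
      have h1 : dist x b < ρ1 := (Metric.mem_ball.1 hx.2).trans (by linarith)
      have : x ∈ Ψ ⁻¹' upperHalf _ ∩ O := hOD ▸ ⟨hx.1, hball h1⟩
      exact ⟨this.1, h1⟩
    refine le_trans (setLIntegral_mono' (hΩ.inter Metric.isOpen_ball).measurableSet
      fun x hx => ?_) (lintegral_mono_set fun x hx => (hsub hx).1)
    obtain ⟨hxD, hxb⟩ := hsub hx
    have hx0 : 0 < (Ψ x).2 := hxD
    have h1 := (hcmp x hx.1 hxb).1
    have hfx : f x = φ x := by rw [hf]; simp only; rw [hχ1 x hx.2, one_mul]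
    have hδ0 : 0 < bdryDist Ω x := pos_of_mul_pos_right (hx0.trans_le h1) hM0.le
    rw [hfx, ← ENNReal.ofReal_mul (by positivity), ← ENNReal.ofReal_mul (by positivity)]
    refine ENNReal.ofReal_le_ofReal ?_
    rw [Real.rpow_neg hx0.le, ← div_eq_mul_inv, mul_div_left_comm, div_eq_mul_inv]
    gcongr
    rw [inv_le_comm₀ (by positivity) (by positivity), inv_div, div_le_iff₀ (by positivity),
      mul_comm (_ ^ _), ← Real.mul_rpow hM0.le hδ0.le]
    gcongr
  have hup : ∫⁻ x in upperHalf _, ENNReal.ofReal (x.2 ^ (-(p * s + d))) *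
      ∫⁻ y in Metric.ball x (κ * x.2), ENNReal.ofReal (|F y - F x| ^ p) ≤
      ENNReal.ofReal (M ^ (p * s + d)) * seminormPow s p Ω f := by
    have hin (x : EuclideanSpace ℝ (Fin d)) :
        ∫⁻ y in Metric.ball (Ψ x) (κ * (Ψ x).2), ENNReal.ofReal (|F y - F (Ψ x)| ^ p) =
        ∫⁻ y in Ψ ⁻¹' Metric.ball (Ψ x) (κ * (Ψ x).2), ENNReal.ofReal (|f y - f x| ^ p) := by
      rw [← hΨm.setLIntegral_comp_preimage_emb Ψ.measurableEmbedding]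
      simp only [hF, MeasurableEquiv.symm_apply_apply]
    rw [transfer, seminormPow, ← lintegral_const_mul' _ _ ENNReal.ofReal_ne_top,
      ← lintegral_indicator hDm, ← lintegral_indicator hΩ.measurableSet]
    refine lintegral_mono fun x => ?_
    by_cases hxD : x ∈ Ψ ⁻¹' upperHalf (EuclideanSpace ℝ (Fin (d - 1)))
    swap
    · rw [indicator_of_notMem hxD]; exact zero_le
    rw [indicator_of_mem hxD, hin]
    have hx0 : 0 < (Ψ x).2 := hxD
    have hdist {y} (hy : y ∈ Ψ ⁻¹' Metric.ball (Ψ x) (κ * (Ψ x).2)) :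
        dist y x < M * (κ * (Ψ x).2) :=
      (hΨ' y x).trans_lt (mul_lt_mul_of_pos_left hy hM0)
    by_cases hxb : dist x b < ρ1
    · have hxΩ : x ∈ Ω := by
        have : x ∈ Ω ∩ O := hOD ▸ ⟨hxD, hball hxb⟩
        exact this.1
      obtain ⟨h1, h2⟩ := hcmp x hxΩ hxb
      have hδ0 : 0 < bdryDist Ω x := pos_of_mul_pos_right (hx0.trans_le h1) hM0.le
      have hsub : Ψ ⁻¹' Metric.ball (Ψ x) (κ * (Ψ x).2) ⊆ Ω ∩ Metric.ball x (bdryDist Ω x) := by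
        intro y hy
        have h3 : M * (κ * (Ψ x).2) ≤ M * (κ * (M * bdryDist Ω x)) := by gcongr
        have h4 : dist y x < bdryDist Ω x := by
          have := hdist hy
          have h5 : M * (κ * (M * bdryDist Ω x)) = 1 / 2 * bdryDist Ω x := by
            rw [← hκM]; ring
          linarith
        exact ⟨ball_bdryDist_subset hΩ hxΩ h4, h4⟩
      rw [indicator_of_mem hxΩ, ← lintegral_const_mul' _ _ ENNReal.ofReal_ne_top,
        ← lintegral_const_mul' _ _ ENNReal.ofReal_ne_top]
      refine le_trans (lintegral_mono_set hsub) (lintegral_mono fun y => ?_)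
      rw [← ENNReal.ofReal_mul (by positivity), ← ENNReal.ofReal_mul (by positivity),
        mul_div_assoc', mul_comm, mul_div_right_comm]
      refine ENNReal.ofReal_le_ofReal ?_
      rw [mul_comm]
      gcongr
      rw [Real.rpow_neg hx0.le, inv_le_comm₀ (by positivity) (by positivity), inv_div,
        div_le_iff₀ (by positivity), mul_comm (_ ^ _), ← Real.mul_rpow hM0.le hx0.le,
        add_comm (d : ℝ)]
      gcongr
    -- Here `x` may lie outside `Ω`, but nothing is lost: if `f y ≠ 0`, the height of `x` is at most
    -- twice that of `y`, which forces `dist x y < ρ1 / 2` and so `dist x b < ρ1`.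
    · have hz : ∀ y ∈ Ψ ⁻¹' Metric.ball (Ψ x) (κ * (Ψ x).2), f y = 0 := by
        intro y hy
        by_contra hfy
        obtain ⟨hyb, hyS⟩ := hf0 y hfy
        have hyΩ := hφΩ hyS
        have h1 := (hcmp y hyΩ (by linarith)).1
        have h2 : bdryDist Ω y ≤ dist y b := Metric.infDist_le_dist_of_mem hb
        have h3 : |(Ψ y).2 - (Ψ x).2| < κ * (Ψ x).2 :=
          (le_max_right _ _).trans_lt (Metric.mem_ball.1 hy)
        have h4 := (abs_lt.1 h3).1
        have h5 : (Ψ x).2 ≤ M * ρ1 := by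
          have h6 : M * bdryDist Ω y ≤ M * (ρ1 / 2) := by gcongr; linarith
          nlinarith
        have h7 : M * (κ * (Ψ x).2) ≤ ρ1 / 2 := by
          have : M * (κ * (Ψ x).2) ≤ M * (κ * (M * ρ1)) := by gcongr
          have h8 : M * (κ * (M * ρ1)) = 1 / 2 * ρ1 := by rw [← hκM]; ring
          linarith
        have h9 := hdist hy
        have h10 := dist_triangle x y b
        rw [dist_comm x y] at h10
        exact hxb (by linarith)
      have hxx : f x = 0 := hz x (Metric.mem_ball_self (by positivity))
      have : ∫⁻ y in Ψ ⁻¹' Metric.ball (Ψ x) (κ * (Ψ x).2), ENNReal.ofReal (|f y - f x| ^ p) = 0 := by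
        rw [← nonpos_iff_eq_zero]
        refine (setLIntegral_mono' (g := fun _ => 0) (Ψ.measurable Metric.isOpen_ball.measurableSet)
          fun y hy => ?_).trans (by simp)
        simp [hz y hy, hxx, Real.zero_rpow hp0.ne']
      rw [this, mul_zero]
      exact zero_le
  calc _ ≤ _ := hlow
    _ ≤ ENNReal.ofReal (M ^ (p * s)) * (C2 * (ENNReal.ofReal (M ^ (p * s + d)) *
        (C1 * energy s p Ω φ))) := by
      gcongr
      refine hH.trans ?_
      gcongr
      refine hup.trans ?_
      gcongr
      exact le_trans le_add_self (hC1 φ hφL.continuous.measurable)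
    _ = _ := by
      simp only [ENNReal.ofReal, ENNReal.coe_mul, mul_assoc]

/-! ### The global inequality for compactly supported Lipschitz functions -/

theorem exists_hardy_of_lipschitz (hp : 1 ≤ p) (hs : s ≤ 1) (hps : 1 < p * s) (hd : 1 ≤ d)
    (hΩ : IsLipschitzDomain Ω) (hΩb : Bornology.IsBounded Ω) (hne : (frontier Ω).Nonempty) :
    ∃ C : ℝ≥0, ∀ φ, IsLipschitzCompactlySupportedIn Ω φ →
      ∫⁻ x in Ω, ENNReal.ofReal (|φ x| ^ p / bdryDist Ω x ^ (p * s)) ≤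
        C * energy s p Ω φ := by
  obtain ⟨hΩo, hfc, N, O, D, hO, hcov, hD, hOD⟩ := hΩ
  obtain ⟨U, hUo, hU, C, hC⟩ : ∃ U, IsOpen U ∧ frontier Ω ⊆ U ∧ ∃ C : ℝ≥0,
      ∀ φ, IsLipschitzCompactlySupportedIn Ω φ →
      ∫⁻ x in Ω ∩ U, ENNReal.ofReal (|φ x| ^ p / bdryDist Ω x ^ (p * s)) ≤
        C * energy s p Ω φ := by
    refine hfc.induction_on (p := fun S => ∃ U, IsOpen U ∧ S ⊆ U ∧ ∃ C : ℝ≥0,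
      ∀ φ, IsLipschitzCompactlySupportedIn Ω φ →
      ∫⁻ x in Ω ∩ U, ENNReal.ofReal (|φ x| ^ p / bdryDist Ω x ^ (p * s)) ≤
        C * energy s p Ω φ) ⟨∅, isOpen_empty, subset_rfl, 0, by simp⟩ ?_ ?_ ?_
    · rintro S T hST ⟨U, hU, hTU, h⟩
      exact ⟨U, hU, hST.trans hTU, h⟩
    · rintro S T ⟨U, hU, hSU, C, hC⟩ ⟨U', hU', hTU', C', hC'⟩
      refine ⟨U ∪ U', hU.union hU', union_subset_union hSU hTU', C + C', fun φ hφ => ?_⟩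
      rw [inter_union_distrib_left, ENNReal.coe_add, add_mul]
      exact (lintegral_union_le _ _ _).trans (add_le_add (hC φ hφ) (hC' φ hφ))
    · intro b hb
      obtain ⟨j, hj⟩ := mem_iUnion.1 (hcov hb)
      obtain ⟨r, C, hr, hC⟩ := exists_local_hardy hp hs hps hd hΩo hΩb hfc (hO j).1 (hD j) (hOD j)
        hb hj
      exact ⟨Metric.ball b r, mem_nhdsWithin_of_mem_nhds (Metric.ball_mem_nhds b hr),
        Metric.ball b r, Metric.isOpen_ball, subset_rfl, C, hC⟩
  -- Off `U` the boundary distance is at least `η`, so the `L^p` part of the energy suffices.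
  obtain ⟨η, hη, hηU⟩ := hfc.exists_thickening_subset_open hUo hU
  refine ⟨C + ((η ^ (p * s))⁻¹).toNNReal, fun φ hφ => ?_⟩
  have hsplit : Ω ⊆ (Ω ∩ U) ∪ (Ω \ U) := (inter_union_sdiff Ω U).ge
  refine (lintegral_mono_set hsplit).trans ((lintegral_union_le _ _ _).trans ?_)
  rw [ENNReal.coe_add, add_mul]
  refine add_le_add (hC φ hφ) ?_
  calc _ ≤ ∫⁻ x in Ω \ U, ENNReal.ofReal ((η ^ (p * s))⁻¹) * ENNReal.ofReal (|φ x| ^ p) := by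
        refine setLIntegral_mono' (hΩo.measurableSet.diff hUo.measurableSet) fun x hx => ?_
        rw [← ENNReal.ofReal_mul (by positivity), mul_comm (_⁻¹), ← div_eq_mul_inv]
        have h1 : η ≤ bdryDist Ω x := by
          by_contra h
          exact hx.2 (hηU ((Metric.mem_thickening_iff_infDist_lt hne).2 (not_le.1 h)))
        gcongr
    _ ≤ ∫⁻ x in Ω, ENNReal.ofReal ((η ^ (p * s))⁻¹) * ENNReal.ofReal (|φ x| ^ p) :=
        lintegral_mono_set sdiff_subset
    _ ≤ _ := by
        rw [lintegral_const_mul' _ _ ENNReal.ofReal_ne_top]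
        exact mul_le_mul_right le_self_add _

/-! ### Passage to the closure -/

theorem energy_neg (u : EuclideanSpace ℝ (Fin d) → ℝ) :
    energy s p Ω (-u) = energy s p Ω u := by
  have h (x y) : |-u y - -u x| = |u y - u x| := by
    rw [neg_sub_neg, abs_sub_comm]
  simp only [energy, seminormPow, h, Pi.neg_apply, abs_neg]

theorem exists_energy_sub_lt (hp : 1 ≤ p) {u : EuclideanSpace ℝ (Fin d) → ℝ}
    (hu : u ∈ zeroBdrySpace s p Ω) {ε : ℝ≥0} (hε : 0 < ε) :
    ∃ φ, IsLipschitzCompactlySupportedIn Ω φ ∧ energy s p Ω (u - φ) < ε := by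
  have hp0 : 0 < p := by linarith
  obtain ⟨φ, hφ, h⟩ := hu.2 ((ε : ℝ≥0∞) ^ (1 / p))
    (ENNReal.rpow_pos (by simpa using hε) ENNReal.coe_ne_top)
  refine ⟨φ, hφ, ?_⟩
  have := ENNReal.rpow_lt_rpow h hp0
  rwa [fullNorm_rpow hp, ← ENNReal.rpow_mul, one_div_mul_cancel hp0.ne', ENNReal.rpow_one] at this

/-- On `{δ > η}` the error `v - φ` costs at most `η ^ (-p s)` times its energy, and `φ` can be
chosen after `η` to make this negligible. The remaining constant does not see `η`, so exhausting `Ω`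
finishes. -/
theorem hardy_of_approx (hp : 1 ≤ p) (hs0 : 0 < s) (hΩ : IsOpen Ω) (hne : (frontier Ω).Nonempty)
    {C : ℝ≥0}
    (hC : ∀ φ, IsLipschitzCompactlySupportedIn Ω φ →
      ∫⁻ x in Ω, ENNReal.ofReal (|φ x| ^ p / bdryDist Ω x ^ (p * s)) ≤ C * energy s p Ω φ)
    {v : EuclideanSpace ℝ (Fin d) → ℝ} (hv : Measurable v)
    (happ : ∀ ε : ℝ≥0, 0 < ε →
      ∃ φ, IsLipschitzCompactlySupportedIn Ω φ ∧ energy s p Ω (v - φ) < ε) :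
    ∫⁻ x in Ω, ENNReal.ofReal (|v x| ^ p / bdryDist Ω x ^ (p * s)) ≤
      ENNReal.ofReal (2 ^ p) * (C * ENNReal.ofReal (2 ^ p)) * energy s p Ω v := by
  have hp0 : 0 < p := by linarith
  have hset (η : ℝ) : MeasurableSet (Ω ∩ {x | η < bdryDist Ω x}) :=
    hΩ.measurableSet.inter (measurableSet_lt measurable_const (measurable_bdryDist Ω))
  have key (η : ℝ) (hη : 0 < η) : ∫⁻ x in Ω ∩ {x | η < bdryDist Ω x},
      ENNReal.ofReal (|v x| ^ p / bdryDist Ω x ^ (p * s)) ≤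
      ENNReal.ofReal (2 ^ p) * (C * ENNReal.ofReal (2 ^ p)) * energy s p Ω v := by
    set K : ℝ≥0 := Real.toNNReal (2 ^ p) * (Real.toNNReal ((η ^ (p * s))⁻¹) +
      C * Real.toNNReal (2 ^ p)) with hK
    refine ENNReal.le_of_forall_pos_le_add fun ε hε _ => ?_
    -- `K` is the total coefficient of the energy of `v - φ`; adding 1 avoids dividing by zero.
    obtain ⟨φ, hφ, hφε⟩ := happ (ε / (K + 1)) (by positivity)
    have hφm : Measurable φ := hφ.1.choose_spec.continuous.measurable
    have h1 : energy s p Ω φ ≤ ENNReal.ofReal (2 ^ p) *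
        (energy s p Ω (v - φ) + energy s p Ω v) := by
      have := energy_add_le (s := s) hp hΩ (hv.sub hφm).neg hv
      rwa [energy_neg, neg_sub, sub_add_cancel] at this
    have h2 : ∫⁻ x in Ω ∩ {x | η < bdryDist Ω x},
        ENNReal.ofReal (|v x| ^ p / bdryDist Ω x ^ (p * s)) ≤
        ENNReal.ofReal (2 ^ p) * (ENNReal.ofReal ((η ^ (p * s))⁻¹) * energy s p Ω (v - φ) +
          C * energy s p Ω φ) := by
      calc _ ≤ ∫⁻ x in Ω ∩ {x | η < bdryDist Ω x}, ENNReal.ofReal (2 ^ p) *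
            (ENNReal.ofReal ((η ^ (p * s))⁻¹) * ENNReal.ofReal (|(v - φ) x| ^ p) +
              ENNReal.ofReal (|φ x| ^ p / bdryDist Ω x ^ (p * s))) := by
            refine setLIntegral_mono' (hset η) fun x hx => ?_
            have hx' : η < bdryDist Ω x := hx.2
            have hδ0 : 0 < bdryDist Ω x := hη.trans hx'
            rw [← ENNReal.ofReal_mul (by positivity), ← ENNReal.ofReal_add (by positivity)
              (by positivity), ← ENNReal.ofReal_mul (by positivity)]
            refine ENNReal.ofReal_le_ofReal ?_
            have h3 := abs_add_rpow_le hp ((v - φ) x) (φ x)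
            rw [Pi.sub_apply, sub_add_cancel] at h3
            calc _ ≤ (2 ^ p * (|v x - φ x| ^ p + |φ x| ^ p)) / bdryDist Ω x ^ (p * s) := by
                  gcongr
              _ = 2 ^ p * ((bdryDist Ω x ^ (p * s))⁻¹ * |v x - φ x| ^ p +
                  |φ x| ^ p / bdryDist Ω x ^ (p * s)) := by ring
              _ ≤ _ := by
                rw [Pi.sub_apply]
                gcongr
        _ ≤ ∫⁻ x in Ω, ENNReal.ofReal (2 ^ p) *
            (ENNReal.ofReal ((η ^ (p * s))⁻¹) * ENNReal.ofReal (|(v - φ) x| ^ p) +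
              ENNReal.ofReal (|φ x| ^ p / bdryDist Ω x ^ (p * s))) :=
            lintegral_mono_set inter_subset_left
        _ ≤ _ := by
            rw [lintegral_const_mul' _ _ ENNReal.ofReal_ne_top, lintegral_add_left (by fun_prop),
              lintegral_const_mul' _ _ ENNReal.ofReal_ne_top]
            gcongr
            · exact le_self_add
            · exact hC φ hφ
    calc _ ≤ _ := h2
      _ ≤ ENNReal.ofReal (2 ^ p) * (ENNReal.ofReal ((η ^ (p * s))⁻¹) * energy s p Ω (v - φ) +
          C * (ENNReal.ofReal (2 ^ p) * (energy s p Ω (v - φ) + energy s p Ω v))) := by gcongr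
      _ = ENNReal.ofReal (2 ^ p) * (C * ENNReal.ofReal (2 ^ p)) * energy s p Ω v +
          K * energy s p Ω (v - φ) := by
        simp only [hK, ENNReal.ofReal, ENNReal.coe_mul, ENNReal.coe_add]
        ring
      _ ≤ _ := by
        gcongr
        refine (mul_le_mul_right hφε.le _).trans ?_
        rw [← ENNReal.coe_mul, ENNReal.coe_le_coe, mul_div_assoc', div_le_iff₀ (by positivity),
          mul_comm]
        gcongr
        exact le_self_add
  have hunion : Ω = ⋃ n : ℕ, Ω ∩ {x | 1 / ((n : ℝ) + 1) < bdryDist Ω x} := by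
    refine subset_antisymm (fun x hx => ?_) (iUnion_subset fun n => inter_subset_left)
    have hδ0 : 0 < bdryDist Ω x :=
      (isClosed_frontier.notMem_iff_infDist_pos hne).1 fun h => by
        rw [hΩ.frontier_eq] at h; exact h.2 hx
    obtain ⟨n, hn⟩ := exists_nat_one_div_lt hδ0
    exact mem_iUnion.2 ⟨n, hx, hn⟩
  have hres := congrArg (fun S => ∫⁻ x in S,
    ENNReal.ofReal (|v x| ^ p / bdryDist Ω x ^ (p * s))) hunion
  rw [hres, setLIntegral_iUnion_of_directed]
  · exact iSup_le fun n => key (1 / ((n : ℝ) + 1)) (by positivity)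
  · refine Monotone.directed_le fun m n hmn x hx => ⟨hx.1, ?_⟩
    have h1 : 1 / ((m : ℝ) + 1) < bdryDist Ω x := hx.2
    have h2 : 1 / ((n : ℝ) + 1) ≤ 1 / ((m : ℝ) + 1) :=
      one_div_le_one_div_of_le (by positivity) (by gcongr)
    exact h2.trans_lt h1

theorem frontier_nonempty_of_isBounded (hd : 1 ≤ d) (hΩb : Bornology.IsBounded Ω)
    (hne : Ω.Nonempty) : (frontier Ω).Nonempty := by
  by_contra h
  rw [not_nonempty_iff_eq_empty, ← isClopen_iff_frontier_eq_empty, isClopen_iff] at h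
  rcases h with rfl | rfl
  · exact not_nonempty_empty hne
  · have : Nonempty (Fin d) := ⟨⟨0, hd⟩⟩
    exact NormedSpace.unbounded_univ ℝ (EuclideanSpace ℝ (Fin d)) hΩb

end NonlocalHardy

end

theorem proposition5p2 (d : ℕ) (hd : 2 ≤ d) (s p : ℝ) (hp : 1 ≤ p) (hs0 : 0 < s) (hs1 : s ≤ 1)
    (hps : 1 < p * s) (Ω : Set (EuclideanSpace ℝ (Fin d)))
    (hΩ : NonlocalHardy.IsLipschitzDomain Ω) (hbdd : Bornology.IsBounded Ω) :
    ∃ C : ℝ, 0 < C ∧ ∀ u ∈ NonlocalHardy.zeroBdrySpace s p Ω,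
      NonlocalHardy.fullNorm s p Ω u < ∞ ∧
      ∫⁻ x in Ω, ENNReal.ofReal (|u x| ^ p / NonlocalHardy.bdryDist Ω x ^ (p * s)) ≤
        ENNReal.ofReal C * NonlocalHardy.fullNorm s p Ω u ^ p := by
  have hp0 : 0 < p := by linarith
  -- An empty frontier would give `Metric.infDist` its default value 0. A nonempty bounded `Ω` has
  -- nonempty frontier, since it is not clopen.
  rcases Ω.eq_empty_or_nonempty with rfl | hne
  · refine ⟨1, one_pos, fun u _ => ⟨?_, by simp⟩⟩
    rw [NonlocalHardy.fullNorm_eq hp]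
    simp [NonlocalHardy.energy, NonlocalHardy.seminormPow, hp0]
  have hfne := NonlocalHardy.frontier_nonempty_of_isBounded (by omega) hbdd hne
  obtain ⟨C, hC⟩ := NonlocalHardy.exists_hardy_of_lipschitz hp hs1 hps (by omega) hΩ hbdd hfne
  -- The summand 1 keeps the constant positive when `C = 0`.
  refine ⟨2 ^ p * (C * 2 ^ p) + 1, by positivity, fun u hu => ?_⟩
  -- The energy and the Hardy integral depend only on the class of `u` almost everywhere in `Ω`, and
  -- a measurable representative is needed for `energy_add_le`.
  obtain ⟨v, hv, huv⟩ : ∃ v, Measurable v ∧ u =ᵐ[volume.restrict Ω] v :=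
    ⟨_, hu.1.1.stronglyMeasurable_mk.measurable, hu.1.1.ae_eq_mk⟩
  have happ (ε : ℝ≥0) (hε : 0 < ε) : ∃ φ, NonlocalHardy.IsLipschitzCompactlySupportedIn Ω φ ∧
      NonlocalHardy.energy s p Ω (v - φ) < ε := by
    obtain ⟨φ, hφ, h⟩ := NonlocalHardy.exists_energy_sub_lt hp hu hε
    refine ⟨φ, hφ, ?_⟩
    rwa [NonlocalHardy.energy_congr (huv.symm.sub (Filter.EventuallyEq.refl _ φ))]
  rw [NonlocalHardy.fullNorm_rpow hp, NonlocalHardy.energy_congr huv]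
  constructor
  · obtain ⟨φ, ⟨⟨K, hφ⟩, -⟩, h⟩ := happ 1 one_pos
    have h1 := NonlocalHardy.energy_add_le (s := s) hp hΩ.1
      (hv.sub hφ.continuous.measurable) hφ.continuous.measurable
    rw [sub_add_cancel] at h1
    rw [NonlocalHardy.fullNorm_eq hp, NonlocalHardy.energy_congr huv]
    refine ENNReal.rpow_lt_top_of_nonneg (by positivity) (h1.trans_lt ?_).ne
    exact ENNReal.mul_lt_top ENNReal.ofReal_lt_top (ENNReal.add_lt_top.2
      ⟨h.trans ENNReal.coe_lt_top,
        NonlocalHardy.energy_lt_top_of_lipschitz hp hs1 hΩ.1 hbdd hφ⟩)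
  · have h1 := NonlocalHardy.hardy_of_approx hp hs0 hΩ.1 hfne hC hv happ
    have h2 : ∫⁻ x in Ω, ENNReal.ofReal (|u x| ^ p / NonlocalHardy.bdryDist Ω x ^ (p * s)) =
        ∫⁻ x in Ω, ENNReal.ofReal (|v x| ^ p / NonlocalHardy.bdryDist Ω x ^ (p * s)) := by
      refine lintegral_congr_ae ?_
      filter_upwards [huv] with x hx
      rw [hx]
    rw [h2]
    refine h1.trans ?_
    gcongr
    rw [← ENNReal.ofReal_coe_nnreal, ← ENNReal.ofReal_mul (by positivity),
      ← ENNReal.ofReal_mul (by positivity)]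
    exact ENNReal.ofReal_le_ofReal (by linarith)
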